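/- Let $d\ge 1$, let $\lambda_1>\lambda_2\ge\cdots\ge\lambda_d>0$, let $\rho>0$ and $0<\eta<\frac{1}{2\lambda_1}$, and let $\ell(w)=\frac12 w^\top\mathrm{diag}(\lambda_1,\ldots,\lambda_d)\,w$ for $w\in\mathbb R^d$. Let $w_0$ be sampled from a continuous probability distribution over $\mathbb R^d$ (that is, one that has a density with respect to Lebesgue measure) with $\mathbf E[\|w_0\|^2]<\infty$, where $\|\cdot\|$ is the Euclidean norm, and let $w_1,w_2,\ldots$ be the iterates of Sharpness-Aware Minimization (SAM), $$w_{t+1}=w_t-\eta\,\nabla\ell\!\left(w_t+\rho\,\frac{\nabla\ell(w_t)}{\|\nabla\ell(w_t)\|}\right),\qquad t\ge 0,$$ where the quotient is read as $0$ if $\nabla\ell(w_t)=0$. Let $e_1$ be the first standard basis vector of $\mathbb R^d$. Then, almost surely, for all $\epsilon>0$, for all large enough $t$, one of the following holds: \begin{itemize} \item $\left\|w_t-\frac{\eta\rho\lambda_1e_1}{2-\eta\lambda_1}\right\|\le\epsilon$ and $\left\|w_{t+1}+\frac{\eta\rho\lambda_1e_1}{2-\eta\lambda_1}\right\|\le\epsilon$,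 or \item $\left\|w_t+\frac{\eta\rho\lambda_1e_1}{2-\eta\lambda_1}\right\|\le\epsilon$ and $\left\|w_{t+1}-\frac{\eta\rho\lambda_1e_1}{2-\eta\lambda_1}\right\|\le\epsilon$. \end{itemize} -/

import Mathlib

open MeasureTheory Filter Matrix

noncomputable section

/-- The quadratic loss `ℓ(w) = (1/2) wᵀ diag(lam) w` on `ℝᵈ`. -/
def quadraticLoss {d : ℕ} (lam : Fin d → ℝ) (w : EuclideanSpace ℝ (Fin d)) : ℝ :=
  (1 / 2) * (w.ofLp ⬝ᵥ (Matrix.diagonal lam *ᵥ w.ofLp))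

/-- One step of Sharpness-Aware Minimization on the loss `ℓ` with step size `η` and
neighborhood size `ρ`: `w ↦ w - η ∇ℓ(w + ρ ∇ℓ(w) / ‖∇ℓ(w)‖)`.
(Where `∇ℓ(w) = 0`, the undefined direction `∇ℓ(w) / ‖∇ℓ(w)‖` is read as `0`.) -/
def samStep {d : ℕ} (ℓ : EuclideanSpace ℝ (Fin d) → ℝ) (η ρ : ℝ)
    (w : EuclideanSpace ℝ (Fin d)) : EuclideanSpace ℝ (Fin d) :=
  w - η • gradient ℓ (w + ρ • (‖gradient ℓ w‖⁻¹ • gradient ℓ w))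

/-- The SAM iterates `w₀, w₁, w₂, …` started at `w₀`. -/
def samIterate {d : ℕ} (ℓ : EuclideanSpace ℝ (Fin d) → ℝ) (η ρ : ℝ)
    (w₀ : EuclideanSpace ℝ (Fin d)) : ℕ → EuclideanSpace ℝ (Fin d)
  | 0 => w₀
  | t + 1 => samStep ℓ η ρ (samIterate ℓ η ρ w₀ t)

/-- The point `(η ρ λ₁ / (2 - η λ₁)) e₁`, with the first coordinate indexed by `0`. -/
def bouncePoint {d : ℕ} [NeZero d] (lam : Fin d → ℝ) (η ρ : ℝ) : EuclideanSpace ℝ (Fin d) :=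
  (η * ρ * lam 0 / (2 - η * lam 0)) • EuclideanSpace.single (0 : Fin d) (1 : ℝ)

end

/-! ### Preimages of null sets under a linear map plus a term homogeneous of degree zero -/

section NullPreimage

/-! In the gradient coordinates `v = diag(lam) w`, SAM multiplies each `v i` by `a i - b i / ‖v‖`,
with `a i = 1 - η * lam i` and `b i = η * ρ * lam i ^ 2`. Up to a global sign this is preconditioned
gradient descent on the even function `J v = (∑ c i * v i ^ 2) / 2 - ‖v‖`, where `c i = (1 + a i) /
b i`. `J` is bounded below and decreases (`gradPotential_gradStep_le`), so its gradient tends to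
zero along the orbit. Hence `‖v‖` approaches the critical values `1 / c i`, of which `1 / c 0` is
strictly the largest.

Below `1 / c 0` the leading coordinate is expanded, so an orbit on which it never vanishes must have
`‖v‖ → 1 / c 0` (`tendsto_norm_mul`). The other coordinates then die out, and the leading multiplier
tends to `-1`, which gives the bouncing.

The leading coordinate almost surely never vanishes, because the step pulls null sets back to null
sets (`addHaar_preimage_sub_norm_inv_smul_eq_zero`). -/

theorem hasStrictFDerivAt_sub_norm_inv_smul {E : Type*} [NormedAddCommGroup E]
    [InnerProductSpace ℝ E] (A B : E →L[ℝ] E) {v : E} (hv : v ≠ 0) :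
    HasStrictFDerivAt (fun v => A v - ‖v‖⁻¹ • B v)
      (A - (‖v‖⁻¹ • B + ((-(‖v‖ ^ 2)⁻¹) • fderiv ℝ (fun x : E => ‖x‖) v).smulRight (B v))) v := by
  have h1 : HasStrictFDerivAt (fun x : E => ‖x‖) (fderiv ℝ (fun x : E => ‖x‖) v) v :=
    (contDiffAt_norm ℝ (n := 1) hv).hasStrictFDerivAt one_ne_zero
  have h2 := (hasStrictDerivAt_inv (norm_ne_zero_iff.2 hv)).comp_hasStrictFDerivAt v h1
  exact A.hasStrictFDerivAt.sub (h2.smul B.hasStrictFDerivAt)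

variable {E : Type*} [NormedAddCommGroup E] [InnerProductSpace ℝ E] [FiniteDimensional ℝ E]
  [MeasurableSpace E] [BorelSpace E]

/-- A measurable set that meets every open ray from the origin in a countable set is null. -/
theorem addHaar_eq_zero_of_countable_on_rays (μ : Measure E) [μ.IsAddHaarMeasure] {S : Set E}
    (hS : MeasurableSet S) (h : ∀ x, {c : ℝ | 0 < c ∧ c • x ∈ S}.Countable) : μ S = 0 := by
  -- Fubini on pairs (point, scale): the slices at fixed `x` are countable, so for some `c > 0` the
  -- slice `c⁻¹ • S` is null, and scaling back gives `S` null.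
  let T : Set (E × ℝ) := {p | 0 < p.2 ∧ p.2 • p.1 ∈ S}
  have hT : MeasurableSet T := by
    refine (measurableSet_lt measurable_const measurable_snd).inter ?_
    exact (measurable_snd.smul measurable_fst) hS
  have h0 : (μ.prod (volume : Measure ℝ)) T = 0 := by
    rw [Measure.measure_prod_null hT]
    exact Eventually.of_forall fun x => (h x).measure_zero _
  have h1 : ∀ᵐ c : ℝ, μ ((fun x => (x, c)) ⁻¹' T) = 0 := by
    have := Measure.measure_ae_null_of_prod_null (μ := (volume : Measure ℝ)) (ν := μ)
      (s := Prod.swap ⁻¹' T) (by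
        rw [← Measure.prod_swap, Measure.map_apply measurable_swap hT] at h0
        exact h0)
    exact this
  obtain ⟨c, hc, hc1⟩ : ∃ c : ℝ, μ ((fun x => (x, c)) ⁻¹' T) = 0 ∧ c ∈ Set.Ioo (0 : ℝ) 1 := by
    have h2 : ∃ᵐ c : ℝ, c ∈ Set.Ioo (0 : ℝ) 1 := by
      rw [frequently_ae_mem_iff]; simp
    exact (h1.and_frequently h2).exists
  have h3 : (fun x : E => (x, c)) ⁻¹' T = (c • · ) ⁻¹' S := by
    ext x; simp [T, hc1.1]
  rw [h3, Measure.addHaar_preimage_smul μ hc1.1.ne'] at hc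
  simpa [hc1.1.ne'] using hc

/-- Preimages of null sets are null, up to the critical set. -/
theorem addHaar_preimage_inter_eq_zero_of_det_ne_zero (μ : Measure E) [μ.IsAddHaarMeasure]
    {F : E → E} (hF : Measurable F) {R : Set E} (hR : MeasurableSet R) {F' : E → E →L[ℝ] E}
    (hd : ∀ x ∈ R, HasStrictFDerivAt F (F' x) x) (hdet : ∀ x ∈ R, (F' x).det ≠ 0)
    {N : Set E} (hN : μ N = 0) : μ (F ⁻¹' N ∩ R) = 0 := by
  refine measure_null_of_locally_null _ fun x hx => ?_
  have hx' : HasStrictFDerivAt F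
      (((F' x).toContinuousLinearEquivOfDetNeZero (hdet x hx.2) : E ≃L[ℝ] E) : E →L[ℝ] E) x := by
    simpa using hd x hx.2
  let P := hx'.toOpenPartialHomeomorph F
  have hPx : x ∈ P.source := hx'.mem_toOpenPartialHomeomorph_source
  have hPF : (P : E → E) = F := hx'.toOpenPartialHomeomorph_coe
  let U : Set E := F ⁻¹' (toMeasurable μ N) ∩ R ∩ P.source
  have hU : MeasurableSet U :=
    ((hF (measurableSet_toMeasurable μ N)).inter hR).inter P.open_source.measurableSet
  have hinj : Set.InjOn F U := by
    have := P.injOn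
    rw [hPF] at this
    exact this.mono Set.inter_subset_right
  -- By change of variables this integral is the measure of `F '' U`, which lies in a null set. The
  -- integrand is positive on `U`, so `U` is null.
  have himg : ∫⁻ y in U, ENNReal.ofReal |(F' y).det| ∂μ = 0 := by
    rw [lintegral_abs_det_fderiv_eq_addHaar_image μ hU
      (fun y hy => (hd y hy.1.2).hasFDerivAt.hasFDerivWithinAt) hinj]
    refine measure_mono_null (t := toMeasurable μ N) ?_ (by rw [measure_toMeasurable, hN])
    rintro _ ⟨y, hy, rfl⟩
    exact hy.1.1
  have hU0 : μ U = 0 := by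
    have hae := (setLIntegral_eq_zero_iff' hU (aemeasurable_ofReal_abs_det_fderivWithin μ hU
      fun y hy => (hd y hy.1.2).hasFDerivAt.hasFDerivWithinAt)).1 himg
    refine measure_mono_null (fun y hy => ?_) (ae_iff.1 hae)
    intro hc
    simpa [hdet y hy.1.2] using hc hy
  refine ⟨F ⁻¹' N ∩ R ∩ P.source,
    inter_mem_nhdsWithin _ (P.open_source.mem_nhds hPx), measure_mono_null ?_ hU0⟩
  exact Set.inter_subset_inter_left _
    (Set.inter_subset_inter_left _ (Set.preimage_mono (subset_toMeasurable μ N)))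

/-- Only the critical set needs care. The derivative of `‖v‖⁻¹ • B v` is homogeneous of degree `-1`,
so at `c • x` the derivative of the whole map is `A - c⁻¹ • (A ∘ M)`, with `M` depending on `x`
alone. It is singular only if `c` is an eigenvalue of `M`, so each ray carries finitely many
critical points. -/
theorem addHaar_preimage_sub_norm_inv_smul_eq_zero [Nontrivial E] (μ : Measure E)
    [μ.IsAddHaarMeasure] (A : E ≃L[ℝ] E) (B : E →L[ℝ] E) {N : Set E} (hN : μ N = 0) :
    μ ((fun v => A v - ‖v‖⁻¹ • B v) ⁻¹' N) = 0 := by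
  set F : E → E := fun v => A v - ‖v‖⁻¹ • B v with hF
  have hFm : Measurable F := by
    have := A.continuous.measurable
    have := B.continuous.measurable
    fun_prop
  have hder : ∀ v ≠ (0 : E), HasStrictFDerivAt F (fderiv ℝ F v) v := fun v hv => by
    have := hasStrictFDerivAt_sub_norm_inv_smul (A : E →L[ℝ] E) B hv
    have h' : HasStrictFDerivAt F _ v := this
    rw [h'.hasFDerivAt.fderiv]
    exact h'
  have hdetm : Measurable fun v => (fderiv ℝ F v).det :=
    ContinuousLinearMap.continuous_det.measurable.comp (measurable_fderiv ℝ F)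
  let Z : Set E := {v | v ≠ 0 ∧ (fderiv ℝ F v).det = 0}
  let R : Set E := {v | v ≠ 0 ∧ (fderiv ℝ F v).det ≠ 0}
  have h0m : MeasurableSet {v : E | v ≠ 0} := (measurableSet_singleton 0).compl
  have hZm : MeasurableSet Z := h0m.inter (hdetm (measurableSet_singleton 0))
  have hRm : MeasurableSet R := h0m.inter (hdetm (measurableSet_singleton 0).compl)
  have hZ : μ Z = 0 := by
    refine addHaar_eq_zero_of_countable_on_rays μ hZm fun x => ?_
    let M : E →ₗ[ℝ] E := A.symm.toLinearMap ∘ₗ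
      ((‖x‖⁻¹ • B + ((-(‖x‖ ^ 2)⁻¹) • fderiv ℝ (fun x : E => ‖x‖) x).smulRight (B x) : E →L[ℝ] E) :
        E →ₗ[ℝ] E)
    have hfin : {c : ℝ | Module.End.HasEigenvalue M c}.Finite := Module.End.finite_hasEigenvalue M
    refine (hfin.subset ?_).countable
    rintro c ⟨hc, hcx, hdet⟩
    have hFd := (hasStrictFDerivAt_sub_norm_inv_smul (A : E →L[ℝ] E) B hcx).hasFDerivAt.fderiv
    change fderiv ℝ F (c • x) = _ at hFd
    obtain ⟨h, hh, hh0⟩ : ∃ h ≠ 0, fderiv ℝ F (c • x) h = 0 := by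
      have := (LinearMap.bot_lt_ker_of_det_eq_zero hdet).ne'
      obtain ⟨h, hh, hh0⟩ := (Submodule.ne_bot_iff _).1 this
      exact ⟨h, hh0, hh⟩
    refine Module.End.hasEigenvalue_of_hasEigenvector (x := h)
      (Module.End.hasEigenvector_iff.2 ⟨Module.End.mem_eigenspace_iff.2 ?_, hh⟩)
    rw [hFd, fderiv_norm_smul_pos hc] at hh0
    have hnx : ‖x‖ ≠ 0 := by
      rintro hx
      simp [norm_eq_zero.1 hx] at hcx
    have hA : A h = c⁻¹ • (‖x‖⁻¹ • B h + (-(‖x‖ ^ 2)⁻¹ * fderiv ℝ (fun x : E => ‖x‖) x h) • B x) := by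
      have : A h = ‖c • x‖⁻¹ • B h +
          (-(‖c • x‖ ^ 2)⁻¹ * fderiv ℝ (fun x : E => ‖x‖) x h) • B (c • x) := by
        rw [← sub_eq_zero]
        simpa using hh0
      rw [this, norm_smul, Real.norm_of_nonneg hc.le, map_smul, smul_add, smul_smul, smul_smul,
        smul_smul]
      congr 2 <;> field_simp
    have : M h = A.symm (‖x‖⁻¹ • B h + (-(‖x‖ ^ 2)⁻¹ * fderiv ℝ (fun x : E => ‖x‖) x h) • B x) := by
      simp [M]
    rw [this, ContinuousLinearEquiv.symm_apply_eq, map_smul, hA, smul_smul, mul_inv_cancel₀ hc.ne',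
      one_smul]
  have hR : μ (F ⁻¹' N ∩ R) = 0 :=
    addHaar_preimage_inter_eq_zero_of_det_ne_zero μ hFm hRm (fun v hv => hder v hv.1)
      (fun v hv => hv.2) hN
  refine measure_mono_null (t := {0} ∪ Z ∪ (F ⁻¹' N ∩ R)) (fun v hv => ?_) ?_
  · by_cases hv0 : v = 0
    · exact Or.inl (Or.inl hv0)
    by_cases hd : (fderiv ℝ F v).det = 0
    · exact Or.inl (Or.inr ⟨hv0, hd⟩)
    · exact Or.inr ⟨hv, hv0, hd⟩
  · exact measure_union_null (measure_union_null (measure_singleton _) hZ) hR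

end NullPreimage

/-! ### Lyapunov analysis of the gradient dynamics -/

section BouncingDynamics

open Topology

variable {d : ℕ} {a b : Fin d → ℝ}

theorem EuclideanSpace.tendsto_of_apply {ι α : Type*} [Fintype ι] {l : Filter α}
    {f : α → EuclideanSpace ℝ ι} {x : EuclideanSpace ℝ ι}
    (h : ∀ i, Tendsto (fun t => f t i) l (𝓝 (x i))) : Tendsto f l (𝓝 x) :=
  ((PiLp.continuous_toLp 2 _).tendsto x.ofLp).comp (tendsto_pi_nhds.2 h)

/-- The map `v ↦ ((aᵢ - bᵢ / ‖v‖) vᵢ)ᵢ` followed by the gradients along the SAM iterates. -/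
noncomputable def gradStep (a b : Fin d → ℝ) (v : EuclideanSpace ℝ (Fin d)) :
    EuclideanSpace ℝ (Fin d) :=
  WithLp.toLp 2 fun i => (a i - b i / ‖v‖) * v i

/-- A Lyapunov function for `gradStep a b`. -/
noncomputable def gradPotential (a b : Fin d → ℝ) (v : EuclideanSpace ℝ (Fin d)) : ℝ :=
  (∑ i, (1 + a i) / b i * v i ^ 2) / 2 - ‖v‖

/-- The gradient of `gradPotential a b` away from the origin. -/
noncomputable def gradPotentialGrad (a b : Fin d → ℝ) (v : EuclideanSpace ℝ (Fin d))
    (i : Fin d) : ℝ :=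
  v i * ((1 + a i) / b i - ‖v‖⁻¹)

theorem neg_gradStep_apply (hb : ∀ i, 0 < b i) (v : EuclideanSpace ℝ (Fin d)) (i : Fin d) :
    -gradStep a b v i = v i - b i * gradPotentialGrad a b v i := by
  have := (hb i).ne'
  simp only [gradStep, gradPotentialGrad]
  field_simp
  ring

/-- Concavity of `-‖·‖` bounds it by its tangent at `v` (Cauchy–Schwarz), and the quadratic part is
expanded exactly. The gain `b i * g i ^ 2` minus the second-order cost `(1 + a i) * b i * g i ^ 2 /
2` leaves the stated decrease. -/
theorem gradPotential_gradStep_le (hb : ∀ i, 0 < b i) {v : EuclideanSpace ℝ (Fin d)}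
    (hv : v ≠ 0) :
    gradPotential a b (gradStep a b v) ≤ gradPotential a b v -
      ∑ i, b i * (1 - a i) / 2 * gradPotentialGrad a b v i ^ 2 := by
  have hs : 0 < ‖v‖ := norm_pos_iff.2 hv
  set g := gradPotentialGrad a b v with hg
  have hG : ∀ i, gradStep a b v i = -(v i - b i * g i) := fun i => by
    rw [hg, ← neg_gradStep_apply hb, neg_neg]
  have hcs : ‖v‖ - ∑ i, ‖v‖⁻¹ * (v i * (b i * g i)) ≤ ‖gradStep a b v‖ := by
    have h1 := real_inner_le_norm v (-gradStep a b v)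
    have h2 : inner ℝ v (-gradStep a b v) = ‖v‖ ^ 2 - ∑ i, v i * (b i * g i) := by
      rw [EuclideanSpace.real_norm_sq_eq, PiLp.inner_apply, ← Finset.sum_sub_distrib]
      refine Finset.sum_congr rfl fun i _ => ?_
      simp [hG i]
      ring
    rw [h2, norm_neg] at h1
    rw [← Finset.mul_sum, ← mul_le_mul_iff_right₀ hs]
    calc _ = ‖v‖ ^ 2 - ∑ i, v i * (b i * g i) := by field_simp
      _ ≤ _ := h1
  have hsum : (∑ i, (1 + a i) / b i * gradStep a b v i ^ 2) / 2 =
      (∑ i, (1 + a i) / b i * v i ^ 2) / 2 - ∑ i, ‖v‖⁻¹ * (v i * (b i * g i)) -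
      ∑ i, b i * (1 - a i) / 2 * g i ^ 2 := by
    rw [Finset.sum_div, Finset.sum_div, ← Finset.sum_sub_distrib, ← Finset.sum_sub_distrib]
    refine Finset.sum_congr rfl fun i _ => ?_
    have hgi : v i * ‖v‖⁻¹ = v i * ((1 + a i) / b i) - g i := by
      simp only [hg, gradPotentialGrad]; ring
    have : ‖v‖⁻¹ * (v i * (b i * g i)) = (v i * ((1 + a i) / b i) - g i) * (b i * g i) := by
      rw [← hgi]; ring
    rw [this, hG]
    have := (hb i).ne'
    field_simp
    ring
  simp only [gradPotential]
  linarith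

theorem neg_le_gradPotential {β : ℝ} (hβ : 0 < β) (h : ∀ i, β⁻¹ ≤ (1 + a i) / b i)
    (v : EuclideanSpace ℝ (Fin d)) : -(β / 2) ≤ gradPotential a b v := by
  have h1 : β⁻¹ * ‖v‖ ^ 2 ≤ ∑ i, (1 + a i) / b i * v i ^ 2 := by
    rw [EuclideanSpace.real_norm_sq_eq, Finset.mul_sum]
    exact Finset.sum_le_sum fun i _ => mul_le_mul_of_nonneg_right (h i) (sq_nonneg _)
  have h2 : β⁻¹ * ‖v‖ ^ 2 / 2 - ‖v‖ + β / 2 = β⁻¹ * (‖v‖ - β) ^ 2 / 2 := by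
    field_simp; ring
  have h3 : 0 ≤ β⁻¹ * (‖v‖ - β) ^ 2 / 2 := by positivity
  simp only [gradPotential]
  linarith

theorem tendsto_gradPotentialGrad (ha1 : ∀ i, a i < 1) (hb : ∀ i, 0 < b i)
    {β : ℝ} (hβ : 0 < β) (h : ∀ i, β⁻¹ ≤ (1 + a i) / b i)
    {v : ℕ → EuclideanSpace ℝ (Fin d)} (hv : ∀ t, v (t + 1) = gradStep a b (v t))
    (hv0 : ∀ t, v t ≠ 0) (i : Fin d) :
    Tendsto (fun t => gradPotentialGrad a b (v t) i) atTop (𝓝 0) := by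
  have hstep : ∀ t, gradPotential a b (v (t + 1)) ≤ gradPotential a b (v t) -
      ∑ i, b i * (1 - a i) / 2 * gradPotentialGrad a b (v t) i ^ 2 := fun t => by
    rw [hv]; exact gradPotential_gradStep_le hb (hv0 t)
  have hκ : ∀ j, 0 < b j * (1 - a j) / 2 := fun j =>
    div_pos (mul_pos (hb j) (sub_pos.2 (ha1 j))) two_pos
  have hterm : ∀ t j, 0 ≤ b j * (1 - a j) / 2 * gradPotentialGrad a b (v t) j ^ 2 := fun t j =>
    mul_nonneg (hκ j).le (sq_nonneg _)
  have hanti : Antitone fun t => gradPotential a b (v t) := antitone_nat_of_succ_le fun t =>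
    (hstep t).trans (sub_le_self _ (Finset.sum_nonneg fun j _ => hterm t j))
  have hbdd : BddBelow (Set.range fun t => gradPotential a b (v t)) :=
    ⟨-(β / 2), by rintro _ ⟨t, rfl⟩; exact neg_le_gradPotential hβ h _⟩
  have hlim := tendsto_atTop_ciInf hanti hbdd
  have hdiff := hlim.sub ((tendsto_add_atTop_iff_nat 1).2 hlim)
  rw [sub_self] at hdiff
  have hsq : Tendsto (fun t => b i * (1 - a i) / 2 * gradPotentialGrad a b (v t) i ^ 2) atTop
      (𝓝 0) := by
    refine squeeze_zero (fun t => hterm t i) (fun t => ?_) hdiff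
    have := Finset.single_le_sum (fun j _ => hterm t j) (Finset.mem_univ i)
    have := hstep t
    linarith
  have hsq' : Tendsto (fun t => gradPotentialGrad a b (v t) i ^ 2) atTop (𝓝 0) := by
    have := hsq.const_mul (b i * (1 - a i) / 2)⁻¹
    rw [mul_zero] at this
    refine this.congr fun t => ?_
    rw [← mul_assoc, inv_mul_cancel₀ (hκ i).ne', one_mul]
  have := hsq'.sqrt
  simp only [Real.sqrt_sq_eq_abs, Real.sqrt_zero] at this
  exact (tendsto_zero_iff_abs_tendsto_zero _).2 this

/-- Where the gradient is small, the norm is close to a critical value. -/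
theorem exists_abs_norm_mul_sub_one_lt {v : EuclideanSpace ℝ (Fin d)} (hv : v ≠ 0) {δ : ℝ}
    (hδ : 0 < δ) (h : ∑ i, gradPotentialGrad a b v i ^ 2 < δ ^ 2) :
    ∃ i, |‖v‖ * ((1 + a i) / b i) - 1| < δ := by
  by_contra! hcon
  refine h.not_ge ?_
  have hs : 0 < ‖v‖ := norm_pos_iff.2 hv
  calc δ ^ 2 = ∑ i, (v i / ‖v‖) ^ 2 * δ ^ 2 := by
        simp_rw [div_pow]
        rw [← Finset.sum_mul, ← Finset.sum_div, ← EuclideanSpace.real_norm_sq_eq]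
        field_simp
    _ ≤ _ := Finset.sum_le_sum fun i _ => ?_
  have h1 : gradPotentialGrad a b v i ^ 2 =
      (v i / ‖v‖) ^ 2 * |‖v‖ * ((1 + a i) / b i) - 1| ^ 2 := by
    rw [sq_abs, ← mul_pow]
    congr 1
    simp only [gradPotentialGrad]
    generalize (1 + a i) / b i = c
    field_simp
  rw [h1]
  gcongr
  exact hcon i

theorem tendsto_norm_sub_norm (hb : ∀ i, 0 < b i)
    {v : ℕ → EuclideanSpace ℝ (Fin d)} (hv : ∀ t, v (t + 1) = gradStep a b (v t))
    (hg : ∀ i, Tendsto (fun t => gradPotentialGrad a b (v t) i) atTop (𝓝 0)) :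
    Tendsto (fun t => ‖v (t + 1)‖ - ‖v t‖) atTop (𝓝 0) := by
  have h1 : Tendsto (fun t => v (t + 1) + v t) atTop (𝓝 0) := by
    refine EuclideanSpace.tendsto_of_apply fun i => ?_
    have := (hg i).const_mul (b i)
    rw [mul_zero] at this
    refine this.congr fun t => ?_
    have := neg_gradStep_apply (a := a) hb (v t) i
    rw [hv, PiLp.add_apply]
    linarith
  refine squeeze_zero_norm (fun t => ?_) (tendsto_zero_iff_norm_tendsto_zero.1 h1)
  have := abs_norm_sub_norm_le (v (t + 1)) (-v t)
  rwa [norm_neg, sub_neg_eq_add] at this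

/-- A trajectory whose leading coordinate never vanishes cannot stay below the top critical
norm. -/
theorem not_forall_norm_mul_lt [NeZero d] (ha : ∀ i, 0 < a i) (hb : ∀ i, 0 < b i)
    {v : ℕ → EuclideanSpace ℝ (Fin d)} (hv : ∀ t, v (t + 1) = gradStep a b (v t))
    (hv0 : ∀ t, v t 0 ≠ 0) {δ : ℝ} (hδ : 0 < δ) (T : ℕ) :
    ¬ ∀ t, T ≤ t → ‖v t‖ * ((1 + a 0) / b 0) < 1 - δ := by
  intro hlow
  have ha0 := ha 0
  have hb0 := hb 0
  have hs : ∀ t, 0 < ‖v t‖ := fun t => norm_pos_iff.2 fun h => hv0 t (by simp [h])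
  -- At norms this small the multiplier `a 0 - b 0 / ‖v t‖` is at most `-(1 + δ)`; geometric growth
  -- then contradicts the bound on the norm.
  have hgrow : ∀ t, T ≤ t → (1 + δ) * |v t 0| ≤ |v (t + 1) 0| := fun t ht => by
    have h1 := hlow t ht
    rw [mul_div_assoc', div_lt_iff₀ hb0] at h1
    have h2 : 1 + δ ≤ b 0 / ‖v t‖ - a 0 := by
      rw [le_sub_iff_add_le, le_div_iff₀ (hs t)]
      have h3 : 0 < 1 - δ := by
        by_contra! h
        have := mul_nonpos_of_nonpos_of_nonneg h hb0.le
        have := mul_pos (hs t) (show 0 < 1 + a 0 by linarith)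
        linarith
      nlinarith [mul_pos (hs t) hδ, mul_pos (mul_pos (hs t) hδ) ha0, mul_pos hδ hb0]
    rw [hv]
    simp only [gradStep, abs_mul]
    refine mul_le_mul_of_nonneg_right (h2.trans ?_) (abs_nonneg _)
    rw [abs_sub_comm]
    exact le_abs_self _
  have hpow : ∀ n, (1 + δ) ^ n * |v T 0| ≤ |v (T + n) 0| := fun n => by
    induction n with
    | zero => simp
    | succ n ih =>
      calc (1 + δ) ^ (n + 1) * |v T 0| = (1 + δ) * ((1 + δ) ^ n * |v T 0|) := by ring
        _ ≤ (1 + δ) * |v (T + n) 0| := by gcongr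
        _ ≤ _ := hgrow _ (Nat.le_add_right _ _)
  have hbd : ∀ n, |v (T + n) 0| ≤ ((1 + a 0) / b 0)⁻¹ := fun n => by
    have h1 := hlow (T + n) (Nat.le_add_right _ _)
    have h2 : |v (T + n) 0| ≤ ‖v (T + n)‖ := PiLp.norm_apply_le (v (T + n)) 0
    refine h2.trans ?_
    rw [le_inv_comm₀ (hs _) (by positivity), inv_eq_one_div, le_div_iff₀ (hs _)]
    linarith
  have htop := (tendsto_pow_atTop_atTop_of_one_lt (show 1 < 1 + δ by linarith)).atTop_mul_const
    (abs_pos.2 (hv0 T))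
  obtain ⟨n, hn⟩ := (htop.eventually_gt_atTop ((1 + a 0) / b 0)⁻¹).exists
  exact absurd ((hpow n).trans (hbd n)) hn.not_ge

variable [NeZero d] {v : ℕ → EuclideanSpace ℝ (Fin d)}

/-- Eventually the rescaled norm is either near `1` or below a gap separating `1` from the lower
critical values. Its increments tend to zero, so it cannot jump the gap upwards, and staying below
forever is excluded by `not_forall_norm_mul_lt`. -/
theorem tendsto_norm_mul (ha : ∀ i, 0 < a i) (ha1 : ∀ i, a i < 1) (hb : ∀ i, 0 < b i)
    (hab : ∀ i, i ≠ 0 → (1 + a 0) / b 0 < (1 + a i) / b i)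
    (hv : ∀ t, v (t + 1) = gradStep a b (v t)) (hv0 : ∀ t, v t 0 ≠ 0) :
    Tendsto (fun t => ‖v t‖ * ((1 + a 0) / b 0)) atTop (𝓝 1) := by
  have hvne : ∀ t, v t ≠ 0 := fun t h => hv0 t (by simp [h])
  have hc : ∀ i, 0 < (1 + a i) / b i := fun i => div_pos (by linarith [ha i]) (hb i)
  set c : Fin d → ℝ := fun i => (1 + a i) / b i with hcdef
  change ∀ i, 0 < c i at hc
  change ∀ i, i ≠ 0 → c 0 < c i at hab
  change Tendsto (fun t => ‖v t‖ * c 0) atTop (𝓝 1)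
  have hg := tendsto_gradPotentialGrad ha1 hb (β := (c 0)⁻¹) (inv_pos.2 (hc 0)) (fun i => by
    rw [inv_inv]
    rcases eq_or_ne i 0 with rfl | hi
    · exact le_rfl
    · exact (hab i hi).le) hv hvne
  have hstep : Tendsto (fun t => ‖v (t + 1)‖ * c 0 - ‖v t‖ * c 0) atTop (𝓝 0) := by
    have := (tendsto_norm_sub_norm hb hv hg).mul_const (c 0)
    simpa [sub_mul] using this
  have hsum : Tendsto (fun t => ∑ i, gradPotentialGrad a b (v t) i ^ 2) atTop (𝓝 0) := by
    simpa using tendsto_finsetSum Finset.univ fun i _ => (hg i).pow 2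
  obtain ⟨r, hr, hr0, hr1⟩ : ∃ r : ℝ, (∀ i, i ≠ 0 → c 0 / c i ≤ r) ∧ 0 < r ∧ r < 1 := by
    have h1 : ∀ᶠ r in 𝓝[<] (1 : ℝ), ∀ i, i ≠ 0 → c 0 / c i ≤ r := by
      refine eventually_all.2 fun i => ?_
      by_cases hi : i = 0
      · simp [hi]
      have : c 0 / c i < 1 := (div_lt_one (hc i)).2 (hab i hi)
      filter_upwards [nhdsWithin_le_nhds (lt_mem_nhds this)] with r hr _ using hr.le
    have h2 : ∀ᶠ r in 𝓝[<] (1 : ℝ), 0 < r := nhdsWithin_le_nhds (lt_mem_nhds one_pos)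
    exact (h1.and (h2.and eventually_mem_nhdsWithin)).exists
  rw [Metric.tendsto_atTop]
  intro ε hε
  obtain ⟨δ, hδ, hδε, hδr⟩ : ∃ δ : ℝ, 0 < δ ∧ δ ≤ ε ∧ δ ≤ (1 - r) / 4 :=
    ⟨min ε ((1 - r) / 4), lt_min hε (by linarith), min_le_left _ _, min_le_right _ _⟩
  -- The factor `1 / 4` in the choice of `δ` leaves room for the lower critical values, at most `r`
  -- and blurred by `δ`, to stay under `1 - 2 * δ`.
  have hgap : (1 + δ) * r < 1 - 2 * δ := by nlinarith
  obtain ⟨T, hT⟩ := eventually_atTop.1 ((hsum.eventually (gt_mem_nhds (pow_pos hδ 2))).and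
    (hstep.eventually (Metric.ball_mem_nhds 0 hδ)))
  have hdich : ∀ t, T ≤ t → ‖v t‖ * c 0 < 1 - 2 * δ ∨ |‖v t‖ * c 0 - 1| < δ := fun t ht => by
    obtain ⟨i, hi⟩ := exists_abs_norm_mul_sub_one_lt (hvne t) hδ (hT t ht).1
    rcases eq_or_ne i 0 with rfl | hi0
    · exact Or.inr hi
    left
    calc ‖v t‖ * c 0 = (‖v t‖ * c i) * (c 0 / c i) := by have := (hc i).ne'; field_simp
      _ ≤ (1 + δ) * r := by
          have h1 := (abs_lt.1 hi).2
          change ‖v t‖ * c i - 1 < δ at h1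
          have := div_pos (hc 0) (hc i)
          gcongr
          · linarith
          · exact hr i hi0
      _ < _ := hgap
  have hstay : ∀ t, T ≤ t → ‖v t‖ * c 0 < 1 - 2 * δ → ‖v (t + 1)‖ * c 0 < 1 - 2 * δ :=
    fun t ht hlow => by
      have h1 := (hT t ht).2
      rw [dist_zero_right, Real.norm_eq_abs, abs_lt] at h1
      rcases hdich (t + 1) (by omega) with h | h
      · exact h
      · linarith [(abs_lt.1 h).1]
  refine ⟨T, fun t ht => ?_⟩
  rcases hdich t ht with hlow | hnear
  · exfalso
    refine not_forall_norm_mul_lt ha hb hv hv0 (show 0 < 2 * δ by linarith) t fun n hn => ?_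
    induction n, hn using Nat.le_induction with
    | base => exact hlow
    | succ n hn ih => exact hstay n (ht.trans hn) ih
  · rw [Real.dist_eq]
    exact hnear.trans_le hδε

theorem tendsto_norm_of_gradStep (ha : ∀ i, 0 < a i) (ha1 : ∀ i, a i < 1) (hb : ∀ i, 0 < b i)
    (hab : ∀ i, i ≠ 0 → (1 + a 0) / b 0 < (1 + a i) / b i)
    (hv : ∀ t, v (t + 1) = gradStep a b (v t)) (hv0 : ∀ t, v t 0 ≠ 0) :
    Tendsto (fun t => ‖v t‖) atTop (𝓝 (b 0 / (1 + a 0))) := by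
  have h := (tendsto_norm_mul ha ha1 hb hab hv hv0).mul_const (b 0 / (1 + a 0))
  have h0 := (hb 0).ne'
  have h1 : 1 + a 0 ≠ 0 := by linarith [ha 0]
  rw [one_mul] at h
  refine h.congr fun t => ?_
  field_simp

theorem tendsto_apply_zero_of_gradStep (ha : ∀ i, 0 < a i) (ha1 : ∀ i, a i < 1)
    (hb : ∀ i, 0 < b i) (hab : ∀ i, i ≠ 0 → (1 + a 0) / b 0 < (1 + a i) / b i)
    (hv : ∀ t, v (t + 1) = gradStep a b (v t)) (hv0 : ∀ t, v t 0 ≠ 0) {i : Fin d} (hi : i ≠ 0) :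
    Tendsto (fun t => v t i) atTop (𝓝 0) := by
  have hvne : ∀ t, v t ≠ 0 := fun t h => hv0 t (by simp [h])
  have hc : ∀ i, 0 < (1 + a i) / b i := fun i => div_pos (by linarith [ha i]) (hb i)
  have hg := tendsto_gradPotentialGrad ha1 hb (β := ((1 + a 0) / b 0)⁻¹) (inv_pos.2 (hc 0))
    (fun i => by
      rw [inv_inv]
      rcases eq_or_ne i 0 with rfl | hi
      · exact le_rfl
      · exact (hab i hi).le) hv hvne i
  have hs := (tendsto_norm_of_gradStep ha ha1 hb hab hv hv0).inv₀
    (by have := hc 0; rw [← inv_div]; positivity)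
  rw [inv_div] at hs
  have hd := hs.const_sub ((1 + a i) / b i)
  have hne : (1 + a i) / b i - (1 + a 0) / b 0 ≠ 0 := sub_ne_zero.2 (hab i hi).ne'
  -- The `i`-th gradient component is `v t i` times a factor with limit `c i - c 0 ≠ 0`, so `v t i`
  -- itself tends to zero.
  have hq := hg.div hd hne
  rw [zero_div] at hq
  refine hq.congr' ?_
  filter_upwards [hd.eventually_ne hne] with t ht
  simp only [gradPotentialGrad, Pi.div_apply]
  exact mul_div_cancel_right₀ _ ht

theorem tendsto_abs_apply_of_gradStep (ha : ∀ i, 0 < a i) (ha1 : ∀ i, a i < 1)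
    (hb : ∀ i, 0 < b i) (hab : ∀ i, i ≠ 0 → (1 + a 0) / b 0 < (1 + a i) / b i)
    (hv : ∀ t, v (t + 1) = gradStep a b (v t)) (hv0 : ∀ t, v t 0 ≠ 0) :
    Tendsto (fun t => |v t 0|) atTop (𝓝 (b 0 / (1 + a 0))) := by
  have h1 : Tendsto (fun t => ∑ i ∈ Finset.univ.erase 0, v t i ^ 2) atTop (𝓝 0) := by
    have := tendsto_finsetSum (Finset.univ.erase (0 : Fin d)) fun i hi =>
      (tendsto_apply_zero_of_gradStep ha ha1 hb hab hv hv0 (Finset.ne_of_mem_erase hi)).pow 2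
    simpa using this
  have h2 := (((tendsto_norm_of_gradStep ha ha1 hb hab hv hv0).pow 2).sub h1).sqrt
  have h3 : 0 ≤ b 0 / (1 + a 0) := (div_pos (hb 0) (by linarith [ha 0])).le
  rw [sub_zero, Real.sqrt_sq h3] at h2
  refine h2.congr fun t => ?_
  rw [← Real.sqrt_sq_eq_abs, EuclideanSpace.real_norm_sq_eq,
    ← Finset.add_sum_erase _ _ (Finset.mem_univ (0 : Fin d)), add_sub_cancel_right]

theorem eventually_mul_neg_of_gradStep (ha : ∀ i, 0 < a i) (ha1 : ∀ i, a i < 1)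
    (hb : ∀ i, 0 < b i) (hab : ∀ i, i ≠ 0 → (1 + a 0) / b 0 < (1 + a i) / b i)
    (hv : ∀ t, v (t + 1) = gradStep a b (v t)) (hv0 : ∀ t, v t 0 ≠ 0) :
    ∀ᶠ t in atTop, v t 0 * v (t + 1) 0 < 0 := by
  have hb0 := hb 0
  have ha0 := ha 0
  have h1 : Tendsto (fun t => a 0 - b 0 / ‖v t‖) atTop (𝓝 (-1)) := by
    have h := (tendsto_const_nhds (x := b 0)).div
      (tendsto_norm_of_gradStep ha ha1 hb hab hv hv0) (by positivity)
    have h' := h.const_sub (a 0)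
    have hlim : a 0 - b 0 / (b 0 / (1 + a 0)) = -1 := by
      rw [div_div_cancel₀ hb0.ne']
      ring
    rwa [hlim] at h'
  filter_upwards [h1.eventually (gt_mem_nhds (show (-1 : ℝ) < 0 by norm_num))] with t ht
  rw [hv]
  simp only [gradStep]
  have : 0 < v t 0 ^ 2 := by have := hv0 t; positivity
  nlinarith

end BouncingDynamics

/-! ### From convergence up to sign to alternation -/

section AlternatingLimit

open Topology

theorem eventually_alternating_of_tendsto {d : ℕ} [NeZero d] {w : ℕ → EuclideanSpace ℝ (Fin d)}
    {β : ℝ} (h0 : Tendsto (fun t => |w t 0|) atTop (𝓝 β))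
    (hi : ∀ i, i ≠ 0 → Tendsto (fun t => w t i) atTop (𝓝 0))
    (hsign : ∀ᶠ t in atTop, w t 0 * w (t + 1) 0 < 0) {ε : ℝ} (hε : 0 < ε) :
    ∀ᶠ t in atTop,
      (‖w t - β • EuclideanSpace.single (0 : Fin d) (1 : ℝ)‖ ≤ ε ∧
        ‖w (t + 1) + β • EuclideanSpace.single (0 : Fin d) (1 : ℝ)‖ ≤ ε) ∨
      (‖w t + β • EuclideanSpace.single (0 : Fin d) (1 : ℝ)‖ ≤ ε ∧
        ‖w (t + 1) - β • EuclideanSpace.single (0 : Fin d) (1 : ℝ)‖ ≤ ε) := by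
  set p : EuclideanSpace ℝ (Fin d) := β • EuclideanSpace.single (0 : Fin d) (1 : ℝ) with hp
  -- Normalising the sign of the leading coordinate turns the oscillation into honest convergence to
  -- `p`.
  let u : ℕ → EuclideanSpace ℝ (Fin d) := fun t => if 0 < w t 0 then w t else -w t
  have hu : Tendsto u atTop (𝓝 p) := by
    refine EuclideanSpace.tendsto_of_apply fun i => ?_
    rcases eq_or_ne i 0 with rfl | hne
    · have : p 0 = β := by simp [hp]
      rw [this]
      refine h0.congr fun t => ?_
      by_cases h : 0 < w t 0
      · simp [u, h, abs_of_pos h]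
      · simp [u, h, abs_of_nonpos (not_lt.1 h)]
    · have : p i = 0 := by simp [hp, hne]
      rw [this]
      refine squeeze_zero_norm (fun t => ?_) (tendsto_zero_iff_norm_tendsto_zero.1 (hi i hne))
      by_cases h : 0 < w t 0 <;> simp [u, h]
  have hclose : ∀ᶠ t in atTop, ‖u t - p‖ ≤ ε := by
    filter_upwards [hu.eventually (Metric.ball_mem_nhds p hε)] with t ht
    exact (mem_ball_iff_norm.1 ht).le
  have hpos : ∀ t, 0 < w t 0 → u t - p = w t - p := fun t h => by simp [u, h]
  have hneg : ∀ t, w t 0 < 0 → u t - p = -(w t + p) := fun t h => by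
    simp only [u, h.not_gt, if_false]; abel
  filter_upwards [hsign, hclose, (tendsto_add_atTop_nat 1).eventually hclose] with t hs h1 h2
  rcases mul_neg_iff.1 hs with ⟨hp1, hn2⟩ | ⟨hn1, hp2⟩
  · left
    rw [hpos t hp1] at h1
    rw [hneg _ hn2, norm_neg] at h2
    exact ⟨h1, h2⟩
  · right
    rw [hneg t hn1, norm_neg] at h1
    rw [hpos _ hp2] at h2
    exact ⟨h1, h2⟩

end AlternatingLimit

/-! ### Null sets under the iterated gradient step -/

section DiagonalMaps

variable {d : ℕ}

/-- The diagonal linear automorphism of `ℝᵈ` with non-zero entries `c`. -/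
noncomputable def diagonalEquiv (c : Fin d → ℝ) (hc : ∀ i, c i ≠ 0) :
    EuclideanSpace ℝ (Fin d) ≃L[ℝ] EuclideanSpace ℝ (Fin d) :=
  (LinearEquiv.ofInjectiveEndo
    (Matrix.toEuclideanCLM (𝕜 := ℝ) (diagonal c)).toLinearMap (by
      intro x y h
      ext i
      have := congrArg (fun z : EuclideanSpace ℝ (Fin d) => z i) h
      simpa [Matrix.mulVec_diagonal, hc i] using this)).toContinuousLinearEquiv

@[simp]
theorem diagonalEquiv_apply (c : Fin d → ℝ) (hc : ∀ i, c i ≠ 0) (v : EuclideanSpace ℝ (Fin d))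
    (i : Fin d) : diagonalEquiv c hc v i = c i * v i := by
  change (Matrix.toEuclideanCLM (𝕜 := ℝ) (diagonal c) v) i = c i * v i
  simp [Matrix.mulVec_diagonal]

theorem volume_preimage_gradStep_eq_zero [NeZero d] {a b : Fin d → ℝ} (ha : ∀ i, a i ≠ 0)
    {N : Set (EuclideanSpace ℝ (Fin d))} (hN : volume N = 0) :
    volume (gradStep a b ⁻¹' N) = 0 := by
  have h := addHaar_preimage_sub_norm_inv_smul_eq_zero volume (diagonalEquiv a ha)
    (Matrix.toEuclideanCLM (𝕜 := ℝ) (diagonal b)) hN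
  convert h using 3
  ext v i
  simp [gradStep, Matrix.mulVec_diagonal]
  ring

theorem volume_gradStep_iterate_apply_eq_zero [NeZero d] {a b : Fin d → ℝ} (ha : ∀ i, a i ≠ 0)
    (i : Fin d) (t : ℕ) :
    volume {v : EuclideanSpace ℝ (Fin d) | ((gradStep a b)^[t] v) i = 0} = 0 := by
  induction t with
  | zero =>
    have h := Measure.addHaar_submodule (volume : Measure (EuclideanSpace ℝ (Fin d)))
      (LinearMap.ker (EuclideanSpace.proj i : EuclideanSpace ℝ (Fin d) →L[ℝ] ℝ).toLinearMap)
      (by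
        intro h
        have : EuclideanSpace.single i (1 : ℝ) ∈ LinearMap.ker
          (EuclideanSpace.proj i : EuclideanSpace ℝ (Fin d) →L[ℝ] ℝ).toLinearMap := by
          rw [h]; trivial
        simp at this)
    convert h using 2
    ext v
    simp
  | succ t ih =>
    exact volume_preimage_gradStep_eq_zero ha ih

end DiagonalMaps

/-! ### Reduction of SAM to the gradient dynamics -/

section SharpnessAwareMinimization

variable {d : ℕ}

theorem hasGradientAt_quadraticLoss (lam : Fin d → ℝ) (w : EuclideanSpace ℝ (Fin d)) :
    HasGradientAt (quadraticLoss lam)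
      (WithLp.toLp 2 fun i => lam i * w i : EuclideanSpace ℝ (Fin d)) w := by
  have hfun : quadraticLoss lam = fun w : EuclideanSpace ℝ (Fin d) =>
      ∑ i, lam i / 2 * ((EuclideanSpace.proj i : EuclideanSpace ℝ (Fin d) →L[ℝ] ℝ) w) ^ 2 := by
    ext w
    simp only [quadraticLoss, dotProduct, mulVec_diagonal, Finset.mul_sum,
      PiLp.proj_apply]
    exact Finset.sum_congr rfl fun i _ => by ring
  rw [hasGradientAt_iff_hasFDerivAt, hfun]
  have h := HasFDerivAt.fun_sum (u := Finset.univ) fun i _ =>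
    (((EuclideanSpace.proj i : EuclideanSpace ℝ (Fin d) →L[ℝ] ℝ).hasFDerivAt
      (x := w)).pow 2).const_mul (lam i / 2)
  refine h.congr_fderiv (ContinuousLinearMap.ext fun v => ?_)
  simp [PiLp.inner_apply]
  exact Finset.sum_congr rfl fun i _ => by ring

/-- The identity also covers a vanishing gradient: division by zero gives `0`, in agreement with the
convention in `samStep`. -/
theorem samStep_quadraticLoss_apply (lam : Fin d → ℝ) (η ρ : ℝ) (w : EuclideanSpace ℝ (Fin d))
    (i : Fin d) :
    samStep (quadraticLoss lam) η ρ w i =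
      (1 - η * lam i - η * ρ * lam i ^ 2 /
        ‖(WithLp.toLp 2 fun j => lam j * w j : EuclideanSpace ℝ (Fin d))‖) * w i := by
  simp only [samStep, (hasGradientAt_quadraticLoss lam _).gradient]
  simp only [PiLp.sub_apply, PiLp.smul_apply, PiLp.add_apply, smul_eq_mul]
  ring

theorem diagonalEquiv_samIterate {lam : Fin d → ℝ} (hlam : ∀ i, lam i ≠ 0) (η ρ : ℝ)
    (w : EuclideanSpace ℝ (Fin d)) (t : ℕ) :
    diagonalEquiv lam hlam (samIterate (quadraticLoss lam) η ρ w (t + 1)) =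
      gradStep (fun i => 1 - η * lam i) (fun i => η * ρ * lam i ^ 2)
        (diagonalEquiv lam hlam (samIterate (quadraticLoss lam) η ρ w t)) := by
  ext i
  rw [diagonalEquiv_apply, samIterate, samStep_quadraticLoss_apply]
  have : (WithLp.toLp 2 fun j => lam j * samIterate (quadraticLoss lam) η ρ w t j :
      EuclideanSpace ℝ (Fin d)) = diagonalEquiv lam hlam (samIterate (quadraticLoss lam) η ρ w t) := by
    ext j; simp
  rw [this]
  simp only [gradStep, diagonalEquiv_apply]
  ring

theorem diagonalEquiv_samIterate_eq_iterate {lam : Fin d → ℝ} (hlam : ∀ i, lam i ≠ 0) (η ρ : ℝ)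
    (w : EuclideanSpace ℝ (Fin d)) (t : ℕ) :
    diagonalEquiv lam hlam (samIterate (quadraticLoss lam) η ρ w t) =
      (gradStep (fun i => 1 - η * lam i) (fun i => η * ρ * lam i ^ 2))^[t]
        (diagonalEquiv lam hlam w) := by
  induction t with
  | zero => rfl
  | succ t ih => rw [diagonalEquiv_samIterate, ih, Function.iterate_succ_apply']

end SharpnessAwareMinimization

theorem theorem2 {d : ℕ} [NeZero d] (lam : Fin d → ℝ)
    (hpos : ∀ i, 0 < lam i) (hanti : Antitone lam) (hgap : ∀ i, i ≠ 0 → lam i < lam 0)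
    (ρ : ℝ) (hρ : 0 < ρ) (η : ℝ) (hη : 0 < η) (hη' : η < 1 / (2 * lam 0))
    (μ : Measure (EuclideanSpace ℝ (Fin d))) [IsProbabilityMeasure μ]
    (hμ : μ ≪ (volume : Measure (EuclideanSpace ℝ (Fin d))))
    (hint : Integrable (fun w : EuclideanSpace ℝ (Fin d) => ‖w‖ ^ 2) μ) :
    ∀ᵐ w₀ ∂μ, ∀ ε : ℝ, 0 < ε → ∀ᶠ t : ℕ in atTop,
      (‖samIterate (quadraticLoss lam) η ρ w₀ t - bouncePoint lam η ρ‖ ≤ ε ∧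
        ‖samIterate (quadraticLoss lam) η ρ w₀ (t + 1) + bouncePoint lam η ρ‖ ≤ ε) ∨
      (‖samIterate (quadraticLoss lam) η ρ w₀ t + bouncePoint lam η ρ‖ ≤ ε ∧
        ‖samIterate (quadraticLoss lam) η ρ w₀ (t + 1) - bouncePoint lam η ρ‖ ≤ ε) := by
  have hlam : ∀ i, lam i ≠ 0 := fun i => (hpos i).ne'
  set a : Fin d → ℝ := fun i => 1 - η * lam i with ha_def
  set b : Fin d → ℝ := fun i => η * ρ * lam i ^ 2 with hb_def
  have hsmall : ∀ i, η * lam i < 1 := fun i => by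
    have h1 : lam i ≤ lam 0 := hanti (Fin.zero_le i)
    rw [lt_div_iff₀ (by linarith [hpos 0])] at hη'
    nlinarith [mul_le_mul_of_nonneg_left h1 hη.le, mul_pos hη (hpos 0)]
  have ha : ∀ i, 0 < a i := fun i => sub_pos.2 (hsmall i)
  have ha1 : ∀ i, a i < 1 := fun i => sub_lt_self _ (mul_pos hη (hpos i))
  have hb : ∀ i, 0 < b i := fun i => mul_pos (mul_pos hη hρ) (pow_pos (hpos i) 2)
  -- A smaller eigenvalue raises `a i` and lowers `b i`; the strict spectral gap thus makes `b 0 /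
  -- (1 + a 0)` the strictly largest critical norm.
  have hab : ∀ i, i ≠ 0 → (1 + a 0) / b 0 < (1 + a i) / b i := fun i hi => by
    have h1 := hgap i hi
    have h2 := hpos i
    have h3 := ha 0
    have h4 : a 0 < a i := by simp only [ha_def]; nlinarith
    have h5 : b i < b 0 := by simp only [hb_def]; gcongr
    have := hb i
    have := ha i
    gcongr
  have hnull : ∀ t, ∀ᵐ w ∂μ,
      diagonalEquiv lam hlam (samIterate (quadraticLoss lam) η ρ w t) 0 ≠ 0 := fun t => by
    refine hμ.ae_le (ae_iff.2 ?_)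
    simp only [not_not, diagonalEquiv_samIterate_eq_iterate]
    change volume (diagonalEquiv lam hlam ⁻¹' {v | ((gradStep a b)^[t] v) 0 = 0}) = 0
    rw [Measure.addHaar_preimage_continuousLinearEquiv,
      volume_gradStep_iterate_apply_eq_zero (fun i => (ha i).ne'), mul_zero]
  filter_upwards [ae_all_iff.2 hnull] with w hw ε hε
  set v : ℕ → EuclideanSpace ℝ (Fin d) := fun t =>
    diagonalEquiv lam hlam (samIterate (quadraticLoss lam) η ρ w t) with hv_def
  have hv : ∀ t, v (t + 1) = gradStep a b (v t) := diagonalEquiv_samIterate hlam η ρ w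
  have hvi : ∀ t i, samIterate (quadraticLoss lam) η ρ w t i = (lam i)⁻¹ * v t i := fun t i => by
    simp [hv_def, hlam i]
  refine eventually_alternating_of_tendsto (β := η * ρ * lam 0 / (2 - η * lam 0)) ?_ ?_ ?_ hε
  · have h := (tendsto_abs_apply_of_gradStep ha ha1 hb hab hv hw).const_mul (lam 0)⁻¹
    have hβ : (lam 0)⁻¹ * (b 0 / (1 + a 0)) = η * ρ * lam 0 / (2 - η * lam 0) := by
      have h1 : 1 + a 0 = 2 - η * lam 0 := by simp only [ha_def]; ring
      have h2 : 2 - η * lam 0 ≠ 0 := by linarith [hsmall 0]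
      have h3 := hlam 0
      rw [h1]
      simp only [hb_def]
      field_simp
    rw [hβ] at h
    refine h.congr fun t => ?_
    rw [hvi, abs_mul, abs_of_pos (inv_pos.2 (hpos 0))]
  · intro i hi
    have h := (tendsto_apply_zero_of_gradStep ha ha1 hb hab hv hw hi).const_mul (lam i)⁻¹
    rw [mul_zero] at h
    exact h.congr fun t => (hvi t i).symm
  · filter_upwards [eventually_mul_neg_of_gradStep ha ha1 hb hab hv hw] with t ht
    rw [hvi, hvi, mul_mul_mul_comm]
    exact mul_neg_of_pos_of_neg (mul_pos (inv_pos.2 (hpos 0)) (inv_pos.2 (hpos 0))) ht
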